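/- Let $K$ be a nonarchimedean local field, that is, a locally compact field with respect to a nontrivial nonarchimedean absolute value $|\cdot|$, of any characteristic. Let $\mathcal O=\{x\in K:|x|\le 1\}$ be its ring of integers, $\mathbf F$ its residue field, $q=\#\mathbf F$, and $\pi$ a uniformizer. Let $f(X)\in\mathcal O[[X]]$ be a Frobenius power series for $\pi$, that is, $f(X)\equiv \pi X \bmod X^2$ and $f(X)\equiv X^q \bmod \pi$, and let $F$ be a Lubin–Tate formal group over $\mathcal O$ associated to $f$, that is, a one-dimensional formal group law over $\mathcal O$ having $f$ as an endomorphism. Then for every $a\in\mathcal O$ there is exactly one endomorphism $[a](X)$ of $F$ over $\mathcal O$ such that $[a](X)\equiv aX \bmod X^2$ and $[a]\circ f=f\circ[a]$. Write $$[a](X)=\sum_{n\ge 1}C_{n,F}(a)X^n .$$ Each function $C_{n,F}\colon\mathcal O\to\mathcal O$ is given by a polynomial over $K$, and the functions $$C_{1,F}(x)^{c_0}\,C_{q,F}(x)^{c_1}\cdots C_{q^{k-1},F}(x)^{c_{k-1}},\qquad k\ge 1,\quad 0\le c_j\le q-1,$$ listed once for each integer $m=c_0+c_1q+\dots+c_{k-1}q^{k-1}\ge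 0$ (zeroth powers being the constant function $1$), form an orthonormal basis $(e_m)_{m\ge 0}$ of the space $C(\mathcal O,K)$ of continuous functions $\mathcal O\to K$ with the sup-norm: every $h\in C(\mathcal O,K)$ has a unique representation $h=\sum_{m\ge 0}b_m e_m$ with $b_m\in K$ and $b_m\to 0$, and $\|h\|=\max_m|b_m|$. -/

import Mathlib

open Filter Topology

noncomputable section

/-- The ring of integers `𝒪 = {x : K | ‖x‖ ≤ 1}` of a nonarchimedean normed field `K`. -/
abbrev IntegerRing (K : Type*) [NormedField K] [IsUltrametricDist K] : Subring K :=
  (NormedField.valuation (K := K)).integer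

/-- The ring of integers of a (nonarchimedean) local field is compact, so that the space
`C(IntegerRing K, K)` of continuous functions carries the sup-norm. -/
instance IntegerRing.instCompactSpace (K : Type*) [NontriviallyNormedField K]
    [IsUltrametricDist K] [LocallyCompactSpace K] : CompactSpace (IntegerRing K) := by
  have : ProperSpace K := ProperSpace.of_nontriviallyNormedField_of_weaklyLocallyCompactSpace K
  refine isCompact_iff_compactSpace.mp ?_
  have h : ((IntegerRing K : Subring K) : Set K) = Metric.closedBall 0 1 := by
    ext x
    simp [Valuation.mem_integer_iff, ← NNReal.coe_le_coe]
  rw [h]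
  exact isCompact_closedBall 0 1

/-- A sequence `e₀, e₁, e₂, …` in a normed space `E` over `K` is an orthonormal basis if every
`x` in `E` has a unique representation `x = ∑ cₙ eₙ` with `cₙ ∈ K`, `cₙ → 0`, and for this
representation `‖x‖ = max ‖cₙ‖`. -/
def IsOrthonormalBasis (K : Type*) {E : Type*} [NormedField K] [NormedAddCommGroup E]
    [NormedSpace K E] (e : ℕ → E) : Prop :=
  ∀ x : E, ∃ c : ℕ → K,
    (Tendsto c atTop (𝓝 0) ∧ HasSum (fun n => c n • e n) x) ∧
    IsGreatest (Set.range fun n => ‖c n‖) ‖x‖ ∧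
    ∀ c' : ℕ → K,
      Tendsto c' atTop (𝓝 0) → HasSum (fun n => c' n • e n) x → c' = c

/-- The extension of a sequence `e₀, e₁, …` by `q`-digits: if `m = c₀ + c₁ q + ⋯ + cₖ₋₁ qᵏ⁻¹` with
`0 ≤ cⱼ ≤ q - 1`, its `m`-th term is `e₀ ^ c₀ * e₁ ^ c₁ * ⋯ * eₖ₋₁ ^ cₖ₋₁`. -/
def digitExtension {A : Type*} [CommMonoid A] (q : ℕ) (e : ℕ → A) (m : ℕ) : A :=
  ∏ j ∈ Finset.range (Nat.digits q m).length, e j ^ (Nat.digits q m).getD j 0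

/-- The function `𝒪 → K` given by a polynomial over `K`. -/
def polynomialFunction {K : Type*} [NormedField K] [IsUltrametricDist K] (P : Polynomial K) :
    C(IntegerRing K, K) where
  toFun x := P.eval (x : K)
  continuous_toFun := P.continuous.comp continuous_subtype_val

/-- `f` is a Frobenius power series for the uniformizer `ϖ`: `f ≡ ϖ X` modulo degree `2`, and
`f ≡ X ^ q` modulo `ϖ`, where `q` is the number of elements of the residue field. -/
structure IsFrobeniusSeries {R : Type*} [CommRing R] [IsLocalRing R] (ϖ : R)
    (f : PowerSeries R) : Prop where
  constantCoeff_eq : PowerSeries.constantCoeff f = 0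
  coeff_one_eq : PowerSeries.coeff 1 f = ϖ
  congr : ∀ n, ϖ ∣ PowerSeries.coeff n
    (f - PowerSeries.X ^ Nat.card (IsLocalRing.ResidueField R))

/-- `g` is an endomorphism of the formal group `F`: `g(0) = 0` and
`g(F(X, Y)) = F(g(X), g(Y))`. -/
structure FormalGroup.IsEndomorphism {R : Type*} [CommRing R] (F : FormalGroup R)
    (g : PowerSeries R) : Prop where
  constantCoeff_eq : PowerSeries.constantCoeff g = 0
  map_add : g.subst F.toPowerSeries =
    F.toPowerSeries.subst
      ![g.subst (MvPowerSeries.X 0 : MvPowerSeries (Fin 2) R),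
        g.subst (MvPowerSeries.X 1 : MvPowerSeries (Fin 2) R)]

/-- `F` is a Lubin-Tate formal group associated to the Frobenius power series `f` for the
uniformizer `ϖ`: the series `f` is an endomorphism of `F`. -/
structure IsLubinTate {R : Type*} [CommRing R] [IsLocalRing R] (ϖ : R) (f : PowerSeries R)
    (F : FormalGroup R) : Prop where
  irreducible : Irreducible ϖ
  frobenius : IsFrobeniusSeries ϖ f
  isEndomorphism : F.IsEndomorphism f

/-- `g` is the endomorphism of the Lubin-Tate formal group `F` attached to `a`: an endomorphism of
`F` with `g ≡ a X` modulo degree `2` that commutes with the Frobenius power series `f`. -/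
structure IsBracket {R : Type*} [CommRing R] (f : PowerSeries R) (F : FormalGroup R) (a : R)
    (g : PowerSeries R) : Prop where
  isEndomorphism : F.IsEndomorphism g
  coeff_one_eq : PowerSeries.coeff 1 g = a
  commute : f.subst g = g.subst f

/-- The power series `[a](X)`, the endomorphism of `F` attached to `a` (for a Lubin-Tate formal
group there is exactly one series with the defining property). -/
def bracket {R : Type*} [CommRing R] (f : PowerSeries R) (F : FormalGroup R) (a : R) :
    PowerSeries R :=
  Classical.epsilon (IsBracket f F a)

/-- The coefficient functions `Cₙ` given by `[a](X) = ∑ Cₙ(a) Xⁿ`. -/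
def coefficientFunction {R : Type*} [CommRing R] (f : PowerSeries R) (F : FormalGroup R) (n : ℕ)
    (a : R) : R :=
  PowerSeries.coeff n (bracket f F a)

end

/-! The proof works modulo `ϖ`. Comparing degree-`n` terms in `f ∘ g = g ∘ f` gives `(ϖ - ϖ ^ n) *
gₙ = ` (an expression in lower coefficients). The factor is nonzero for `n ≥ 2`, so a series
commuting with `f` is determined by its linear part. Over `𝒪` the equation is solvable because `g(X
^ q) = g(X) ^ q` over the residue field. Uniqueness then makes each such series an endomorphism of
`F` and yields `[a + b] = F([a], [b])` and `[ϖ a] = [a] ∘ f`.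

Hence `[ϖ ^ n b](X) ≡ [b](X ^ (q ^ n)) = b X ^ (q ^ n) + ⋯`, and adding this in `F` gives the one
congruence on which everything rests (`residue_coefficientFunction_add`): `C_{q ^ n}(a + ϖ ^ n b) ≡
C_{q ^ n}(a) + b`. So `C_{q ^ n}` mod `ϖ` takes every residue value on a coset of `ϖ ^ n`, while the
earlier `C_{q ^ j}` stay constant there. By induction on `n`, the first `q ^ n` digit products
reduce to a basis of the functions `𝒪 / ϖ ^ n → 𝐅`.

Independence of the reductions gives `‖∑ bₘ eₘ‖ = max ‖bₘ‖`; spanning gives density, by successive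
approximation modulo powers of `ϖ`. An isometric image of the null sequences is closed, hence
everything. -/

/-! ### Series commuting with `f`: uniqueness in several variables. -/

namespace MvPowerSeries

variable {R τ : Type*} [CommRing R]

/-- The cofactor `∑ φ ^ i * ψ ^ (d - 1 - i)` has no constant term once `d ≥ 2`, which gains a
degree. So only the linear term of a series sees a lowest-degree discrepancy. -/
lemma order_pow_sub_pow_gt {φ ψ : MvPowerSeries τ R} (hφ : constantCoeff φ = 0)
    (hψ : constantCoeff ψ = 0) {n : ℕ} (h : (n : ℕ∞) ≤ (φ - ψ).order) {d : ℕ} (hd : d ≠ 1) :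
    (n : ℕ∞) + 1 ≤ (φ ^ d - ψ ^ d).order := by
  rcases d with _ | _ | d
  · simp
  · simp at hd
  · rw [← Commute.geom_sum₂_mul (Commute.all φ ψ)]
    refine le_trans ?_ le_order_mul
    rw [add_comm]
    refine add_le_add ?_ h
    rw [one_le_order_iff_constCoeff_eq_zero, map_sum]
    refine Finset.sum_eq_zero fun i hi => ?_
    rw [map_mul, map_pow, map_pow, hφ, hψ]
    rcases eq_or_ne i 0 with rfl | hi
    · simp
    · simp [hi]

/-- If `φ` and `ψ` agree below degree `n`, then in degree `n` the difference of `f ∘ φ` and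
`f ∘ ψ` is that of `φ` and `ψ` times the linear coefficient of `f`. -/
lemma coeff_subst_sub_coeff_subst (f : PowerSeries R) {φ ψ : MvPowerSeries τ R}
    (hφ : constantCoeff φ = 0) (hψ : constantCoeff ψ = 0) {e : τ →₀ ℕ}
    (h : (e.degree : ℕ∞) ≤ (φ - ψ).order) :
    coeff e (f.subst φ) - coeff e (f.subst ψ) =
      PowerSeries.coeff 1 f * (coeff e φ - coeff e ψ) := by
  have sφ := PowerSeries.HasSubst.of_constantCoeff_zero hφ
  have sψ := PowerSeries.HasSubst.of_constantCoeff_zero hψ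
  rw [PowerSeries.coeff_subst sφ, PowerSeries.coeff_subst sψ,
    ← finsum_sub_distrib (PowerSeries.coeff_subst_finite sφ f e)
      (PowerSeries.coeff_subst_finite sψ f e), finsum_eq_single _ 1]
  · simp [mul_sub]
  · intro d hd
    rw [← smul_sub, ← map_sub, coeff_of_lt_order, smul_zero]
    refine lt_of_lt_of_le ?_ (order_pow_sub_pow_gt hφ hψ h hd)
    exact_mod_cast Nat.lt_succ_self _

/-- The lowest homogeneous part of `D (f X₁, …, f Xᵣ)`. -/
lemma coeff_subst_subst_X [Finite τ] {f : PowerSeries R} (hf : PowerSeries.constantCoeff f = 0)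
    {D : MvPowerSeries τ R} {e : τ →₀ ℕ} (h : (e.degree : ℕ∞) ≤ D.order) :
    coeff e (D.subst fun i => (f.subst (X i : MvPowerSeries τ R) : MvPowerSeries τ R)) =
      PowerSeries.coeff 1 f ^ e.degree * coeff e D := by
  classical
  -- With `f = X * u`, the substituted `d`-th monomial is divisible by `X ^ d`. Only `d ≤ e` can
  -- reach degree `e`, and the order of `D` kills every `d < e`.
  obtain ⟨u, rfl⟩ := PowerSeries.X_dvd_iff.mpr hf
  have hu (i : τ) : (PowerSeries.X * u).subst (X i : MvPowerSeries τ R) =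
      X i * u.subst (X i : MvPowerSeries τ R) := by
    rw [PowerSeries.subst_mul (PowerSeries.HasSubst.X i),
      PowerSeries.subst_X (PowerSeries.HasSubst.X i)]
  have hs : HasSubst fun i => X i * u.subst (X i : MvPowerSeries τ R) :=
    hasSubst_of_constantCoeff_zero fun i => by simp
  simp_rw [hu]
  have hprod (d : τ →₀ ℕ) : (d.prod fun i k => (X i * u.subst (X i : MvPowerSeries τ R)) ^ k) =
      monomial d 1 * d.prod fun i k => (u.subst (X i : MvPowerSeries τ R)) ^ k := by
    simp_rw [mul_pow]
    rw [Finsupp.prod_mul, monomial_one_eq]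
  rw [coeff_subst hs, finsum_eq_single _ e]
  · rw [hprod, coeff_monomial_mul, if_pos le_rfl, tsub_self, one_mul,
      coeff_zero_eq_constantCoeff_apply, Finsupp.prod, map_prod]
    have hc (i : τ) : constantCoeff (u.subst (X i : MvPowerSeries τ R)) =
        PowerSeries.constantCoeff u := by
      rw [← coeff_zero_eq_constantCoeff_apply, PowerSeries.coeff_subst_single]
      simp
    simp_rw [map_pow, hc, Finset.prod_pow_eq_pow_sum]
    rw [smul_eq_mul, mul_comm, Finsupp.degree_apply]
    simp
  · intro d hd
    rw [hprod, coeff_monomial_mul]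
    split_ifs with hde
    · rw [coeff_of_lt_order, zero_smul]
      refine lt_of_lt_of_le ?_ h
      have : d.degree < e.degree := by
        obtain ⟨c, rfl⟩ := exists_add_of_le hde
        have hc : c ≠ 0 := by rintro rfl; simp at hd
        rw [map_add]
        have := (Finsupp.degree_eq_zero_iff c).not.mpr hc
        omega
      exact_mod_cast this
    · simp

/-- Lubin-Tate uniqueness: a power series without constant term that commutes with `f` is
determined by its linear part. -/
theorem eq_of_commute [IsDomain R] [Finite τ] {f : PowerSeries R}
    (hf : PowerSeries.constantCoeff f = 0)
    (hf1 : ∀ n, 2 ≤ n → PowerSeries.coeff 1 f - PowerSeries.coeff 1 f ^ n ≠ 0)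
    {φ ψ : MvPowerSeries τ R} (hφ : constantCoeff φ = 0) (hψ : constantCoeff ψ = 0)
    (hlin : ∀ i, coeff (Finsupp.single i 1) φ = coeff (Finsupp.single i 1) ψ)
    (cφ : f.subst φ = φ.subst fun i => (f.subst (X i : MvPowerSeries τ R) : MvPowerSeries τ R))
    (cψ : f.subst ψ = ψ.subst fun i => (f.subst (X i : MvPowerSeries τ R) : MvPowerSeries τ R)) :
    φ = ψ := by
  suffices H : ∀ n, ∀ e : τ →₀ ℕ, e.degree = n → coeff e φ = coeff e ψ from
    ext fun e => H _ e rfl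
  intro n
  induction n using Nat.strong_induction_on with
  | _ n ih =>
    intro e he
    rcases Nat.lt_or_ge n 2 with hn | hn
    · interval_cases n
      · rw [Finsupp.degree_eq_zero_iff] at he
        simp [he, hφ, hψ]
      · have he0 : e ≠ 0 := by rintro rfl; simp at he
        obtain ⟨i, hi⟩ := Finsupp.ne_iff.mp he0
        obtain ⟨c, rfl⟩ := exists_add_of_le
          (Finsupp.single_le_iff.mpr (Nat.one_le_iff_ne_zero.mpr hi))
        rw [map_add, Finsupp.degree_single, Nat.add_eq_left, Finsupp.degree_eq_zero_iff] at he
        simpa [he] using hlin i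
    · have hord : (e.degree : ℕ∞) ≤ (φ - ψ).order := by
        refine nat_le_order fun d hd => ?_
        rw [map_sub, ih _ (he ▸ hd) d rfl, sub_self]
      have h1 := coeff_subst_sub_coeff_subst f hφ hψ hord
      have h2 := coeff_subst_subst_X hf hord
      have hs : HasSubst fun i => (f.subst (X i : MvPowerSeries τ R) : MvPowerSeries τ R) :=
        hasSubst_of_constantCoeff_zero fun i =>
          PowerSeries.constantCoeff_subst_eq_zero (by simp) _ hf
      rw [subst_sub hs, map_sub, ← cφ, ← cψ, h1, map_sub, he] at h2
      -- The lowest part of `φ - ψ` is multiplied by `f₁` under `f ∘ ·` but by `f₁ ^ n` under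
      -- substitution of `f`.
      have h3 : (PowerSeries.coeff 1 f - PowerSeries.coeff 1 f ^ n) *
          (coeff e φ - coeff e ψ) = 0 := by
        linear_combination h2
      exact sub_eq_zero.mp ((mul_eq_zero.mp h3).resolve_left (hf1 n hn))

end MvPowerSeries

/-! ### One variable: uniqueness and recursive existence. -/

namespace PowerSeries

variable {R : Type*} [CommRing R]

lemma constantCoeff_subst_zero {f g : PowerSeries R} (hf : constantCoeff f = 0)
    (hg : constantCoeff g = 0) : constantCoeff (g.subst f) = 0 :=
  constantCoeff_subst_eq_zero hf g hg

lemma map_subst_powerSeries {S : Type*} [CommRing S] (h : R →+* S) {f : PowerSeries R}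
    (hf : HasSubst f) (g : PowerSeries R) :
    PowerSeries.map h (g.subst f) = (g.map h).subst (f.map h) :=
  PowerSeries.map_subst hf g

lemma subst_eq_mvSubst (f g : PowerSeries R) :
    g.subst f = MvPowerSeries.subst
      (fun i => (f.subst (MvPowerSeries.X i : MvPowerSeries Unit R) : MvPowerSeries Unit R)) g := by
  have h : f.subst (X : PowerSeries R) = f := X_subst f
  rw [X] at h
  simp only [h]
  rfl

lemma nat_le_mvOrder {φ : PowerSeries R} {n : ℕ} (h : ∀ m < n, coeff m φ = 0) :
    (n : ℕ∞) ≤ MvPowerSeries.order φ := by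
  refine MvPowerSeries.nat_le_order fun d hd => ?_
  have hd' : d = Finsupp.single () (d ()) := Finsupp.unique_single d
  rw [hd', Finsupp.degree_single] at hd
  rw [hd']
  exact h _ hd

lemma coeff_subst_sub_coeff_subst (f : PowerSeries R) {φ ψ : PowerSeries R}
    (hφ : constantCoeff φ = 0) (hψ : constantCoeff ψ = 0) {n : ℕ}
    (h : ∀ m < n, coeff m φ = coeff m ψ) :
    coeff n (f.subst φ) - coeff n (f.subst ψ) = coeff 1 f * (coeff n φ - coeff n ψ) := by
  refine MvPowerSeries.coeff_subst_sub_coeff_subst f hφ hψ (e := Finsupp.single () n) ?_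
  rw [Finsupp.degree_single]
  exact nat_le_mvOrder fun m hm => by rw [map_sub, h m hm, sub_self]

lemma coeff_subst_of_lt {f : PowerSeries R} (hf : constantCoeff f = 0)
    {D : PowerSeries R} {n : ℕ} (h : ∀ m < n, coeff m D = 0) :
    coeff n (D.subst f) = coeff 1 f ^ n * coeff n D := by
  have := MvPowerSeries.coeff_subst_subst_X hf (D := D) (e := Finsupp.single () n)
    (by rw [Finsupp.degree_single]; exact nat_le_mvOrder h)
  rw [Finsupp.degree_single, ← subst_eq_mvSubst] at this
  exact this

lemma coeff_one_subst {f g : PowerSeries R} (hf : constantCoeff f = 0)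
    (hg : constantCoeff g = 0) : coeff 1 (g.subst f) = coeff 1 f * coeff 1 g := by
  rw [coeff_subst_of_lt hf, pow_one]
  intro m hm
  rw [Nat.lt_one_iff.mp hm, coeff_zero_eq_constantCoeff_apply, hg]

/-- In one variable, a power series without constant term that commutes with `f` is determined by
its linear coefficient. -/
theorem eq_of_commute [IsDomain R] {f : PowerSeries R} (hf : constantCoeff f = 0)
    (hf1 : ∀ n, 2 ≤ n → coeff 1 f - coeff 1 f ^ n ≠ 0)
    {φ ψ : PowerSeries R} (hφ : constantCoeff φ = 0) (hψ : constantCoeff ψ = 0)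
    (hlin : coeff 1 φ = coeff 1 ψ)
    (cφ : f.subst φ = φ.subst f) (cψ : f.subst ψ = ψ.subst f) : φ = ψ :=
  MvPowerSeries.eq_of_commute (τ := Unit) hf hf1 hφ hψ (fun _ => hlin)
    (cφ.trans (subst_eq_mvSubst f φ)) (cψ.trans (subst_eq_mvSubst f ψ))

/-- The coefficients of the series with linear coefficient `a` that commutes with `f`. -/
noncomputable def commuteCoeff (f : PowerSeries R) (a : R) (n : ℕ) : R :=
  if n = 0 then 0 else if n = 1 then a else
    -- `g` is the truncation below degree `n`. The choice is meaningful only if the equation is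
    -- solvable, which `exists_commute` assumes.
    let g : PowerSeries R := mk fun k => if _h : k < n then commuteCoeff f a k else 0
    Classical.epsilon fun x => (coeff 1 f - coeff 1 f ^ n) * x = coeff n (g.subst f - f.subst g)
termination_by n

/-- Lubin-Tate existence: if the equations for the coefficients can be solved, then there is a
power series with given linear coefficient that commutes with `f`. -/
theorem exists_commute {f : PowerSeries R} (hf : constantCoeff f = 0)
    (hsolve : ∀ n, 2 ≤ n → ∀ g : PowerSeries R, constantCoeff g = 0 →
      ∃ x, (coeff 1 f - coeff 1 f ^ n) * x = coeff n (g.subst f - f.subst g)) (a : R) :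
    ∃ g : PowerSeries R, constantCoeff g = 0 ∧ coeff 1 g = a ∧ f.subst g = g.subst f := by
  set G : PowerSeries R := mk (commuteCoeff f a) with hG
  have h0 : constantCoeff G = 0 := by
    rw [← coeff_zero_eq_constantCoeff_apply, hG, coeff_mk, commuteCoeff, if_pos rfl]
  have h1 : coeff 1 G = a := by
    rw [hG, coeff_mk, commuteCoeff, if_neg one_ne_zero, if_pos rfl]
  refine ⟨G, h0, h1, ?_⟩
  have sf := HasSubst.of_constantCoeff_zero' hf
  ext n
  rcases Nat.lt_or_ge n 2 with hn | hn
  · interval_cases n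
    · rw [coeff_zero_eq_constantCoeff_apply, coeff_zero_eq_constantCoeff_apply,
        constantCoeff_subst_zero h0 hf, constantCoeff_subst_zero hf h0]
    · rw [coeff_one_subst hf h0, coeff_one_subst h0 hf, mul_comm]
  · set g : PowerSeries R := mk fun k => if _h : k < n then commuteCoeff f a k else 0 with hg
    have g0 : constantCoeff g = 0 := by
      rw [← coeff_zero_eq_constantCoeff_apply, hg, coeff_mk, dif_pos (by omega), commuteCoeff,
        if_pos rfl]
    have hGn : coeff n G = Classical.epsilon fun x =>
        (coeff 1 f - coeff 1 f ^ n) * x = coeff n (g.subst f - f.subst g) := by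
      rw [hG, coeff_mk, commuteCoeff, if_neg (by omega), if_neg (by omega)]
    have key := Classical.epsilon_spec (hsolve n hn g g0)
    rw [← hGn] at key
    have hlt : ∀ m < n, coeff m G = coeff m g := by
      intro m hm
      rw [hG, hg, coeff_mk, coeff_mk, dif_pos hm]
    have hgn : coeff n g = 0 := by rw [hg, coeff_mk, dif_neg (lt_irrefl n)]
    -- Passing from `g` to `G` changes `f ∘ g` in degree `n` by `f₁ * Gₙ` and `g ∘ f` by `f₁ ^ n *
    -- Gₙ`; `Gₙ` was chosen so that these changes cancel the discrepancy of the truncation.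
    have e1 := coeff_subst_sub_coeff_subst f h0 g0 hlt
    have e2 := coeff_subst_of_lt hf (D := G - g) (n := n)
      fun m hm => by rw [map_sub, hlt m hm, sub_self]
    rw [subst_sub sf, map_sub, map_sub] at e2
    rw [map_sub] at key
    rw [hgn] at e1 e2
    linear_combination e1 - e2 + key

end PowerSeries

/-! ### Substitution into formal group laws. -/

namespace FormalGroup

open PowerSeries

variable {R : Type*} [CommRing R] (F : FormalGroup R) {τ : Type*}

lemma hasSubst_pair {a b : MvPowerSeries τ R} (ha : MvPowerSeries.constantCoeff a = 0)
    (hb : MvPowerSeries.constantCoeff b = 0) : MvPowerSeries.HasSubst ![a, b] :=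
  MvPowerSeries.hasSubst_of_constantCoeff_zero fun s => by fin_cases s <;> simpa

lemma constantCoeff_subst_pair {a b : MvPowerSeries τ R}
    (ha : MvPowerSeries.constantCoeff a = 0) (hb : MvPowerSeries.constantCoeff b = 0) :
    MvPowerSeries.constantCoeff (F.toPowerSeries.subst ![a, b]) = 0 :=
  MvPowerSeries.constantCoeff_subst_eq_zero (hasSubst_pair ha hb)
    (fun s => by fin_cases s <;> simpa) F.zero_constantCoeff

/-- In degree `n`, `F(a, b)` is `a + b` if `b` has order at least `n ≥ 1`. -/
lemma coeff_subst_pair {a b : MvPowerSeries τ R} (ha : MvPowerSeries.constantCoeff a = 0)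
    (hb : MvPowerSeries.constantCoeff b = 0) {e : τ →₀ ℕ}
    (h : (e.degree : ℕ∞) ≤ b.order) :
    MvPowerSeries.coeff e (F.toPowerSeries.subst ![a, b]) =
      MvPowerSeries.coeff e a + MvPowerSeries.coeff e b := by
  have s1 := hasSubst_pair ha hb
  have s0 := hasSubst_pair ha (map_zero _)
  -- Compare with `F(a, 0) = a`. Only the monomial `Y` contributes: `X ^ i * Y` with `i ≥ 1` gains a
  -- degree from `a`, and powers `Y ^ j` with `j ≥ 2` gain one from `b`.
  have key : MvPowerSeries.coeff e (F.toPowerSeries.subst ![a, b]) -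
      MvPowerSeries.coeff e (F.toPowerSeries.subst ![a, 0]) = MvPowerSeries.coeff e b := by
    rw [MvPowerSeries.coeff_subst s1, MvPowerSeries.coeff_subst s0,
      ← finsum_sub_distrib (MvPowerSeries.coeff_subst_finite s1 _ e)
        (MvPowerSeries.coeff_subst_finite s0 _ e), finsum_eq_single _ (Finsupp.single 1 1)]
    · simp [F.lin_coeff_Y]
    · intro d hd
      rw [← smul_sub, ← map_sub]
      simp only [Finsupp.prod_fintype, pow_zero, implies_true, Fin.prod_univ_two,
        Matrix.cons_val_zero, Matrix.cons_val_one, Matrix.cons_val_fin_one, ← mul_sub]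
      by_cases hd1 : d 1 = 1
      · have hd0 : d 0 ≠ 0 := by
          intro hd0
          refine hd (Finsupp.ext fun i => ?_)
          fin_cases i <;> simp [hd0, hd1]
        rw [MvPowerSeries.coeff_of_lt_order (f := a ^ d 0 * (b ^ d 1 - 0 ^ d 1)), smul_zero]
        refine lt_of_lt_of_le ?_ MvPowerSeries.le_order_mul
        have h2 : (1 : ℕ∞) ≤ (a ^ d 0).order := by
          rw [MvPowerSeries.one_le_order_iff_constCoeff_eq_zero, map_pow, ha, zero_pow hd0]
        rw [hd1, pow_one, pow_one, sub_zero]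
        refine lt_of_lt_of_le ?_ (add_le_add h2 h)
        rw [add_comm]
        exact_mod_cast Nat.lt_succ_self _
      · rw [MvPowerSeries.coeff_of_lt_order (f := a ^ d 0 * (b ^ d 1 - 0 ^ d 1)), smul_zero]
        refine lt_of_lt_of_le ?_ MvPowerSeries.le_order_mul
        have h2 := MvPowerSeries.order_pow_sub_pow_gt hb (map_zero _) (n := e.degree)
          (by rwa [sub_zero]) hd1
        refine lt_of_lt_of_le ?_ (h2.trans le_add_self)
        exact_mod_cast Nat.lt_succ_self _
  rw [F.add_zero (HasSubst.of_constantCoeff_zero ha)] at key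
  rw [← key]
  ring

variable {F} {f : PowerSeries R}

lemma IsEndomorphism.subst_pair (h : F.IsEndomorphism f) {a b : MvPowerSeries τ R}
    (ha : MvPowerSeries.constantCoeff a = 0) (hb : MvPowerSeries.constantCoeff b = 0) :
    f.subst (F.toPowerSeries.subst ![a, b]) =
      F.toPowerSeries.subst ![f.subst a, f.subst b] := by
  have s1 := hasSubst_pair ha hb
  have sF : PowerSeries.HasSubst F.toPowerSeries :=
    HasSubst.of_constantCoeff_zero F.zero_constantCoeff
  have hX (i : Fin 2) : MvPowerSeries.constantCoeff
      (f.subst (MvPowerSeries.X i : MvPowerSeries (Fin 2) R)) = 0 :=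
    constantCoeff_subst_eq_zero (by simp) f h.constantCoeff_eq
  have key := congrArg (MvPowerSeries.subst ![a, b]) h.map_add
  rw [MvPowerSeries.subst_comp_subst_apply (hasSubst_pair (hX 0) (hX 1)) s1, PowerSeries.subst,
    MvPowerSeries.subst_comp_subst_apply sF.const s1] at key
  rw [PowerSeries.subst, key]
  congr 1
  funext i
  fin_cases i <;>
  · simp only [PowerSeries.subst, Fin.zero_eta, Fin.mk_one, Matrix.cons_val_zero,
      Matrix.cons_val_one, Matrix.cons_val_fin_one]
    rw [MvPowerSeries.subst_comp_subst_apply (HasSubst.X _).const s1]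
    simp [MvPowerSeries.subst_X s1]

end FormalGroup

namespace FiniteField

open PowerSeries

/-- Over a finite field with `q` elements, `g(X ^ q) = g(X) ^ q`. -/
lemma subst_X_pow_card {k : Type*} [Field k] [Finite k] (g : PowerSeries k) :
    g.subst (X ^ Nat.card k : PowerSeries k) = g ^ Nat.card k := by
  have := Fintype.ofFinite k
  obtain ⟨p, hp, n, hprime, hcard⟩ := FiniteField.card' k
  have : ExpChar k p := ExpChar.prime hprime
  have hid : iterateFrobenius k p n = RingHom.id k := by
    ext x
    rw [iterateFrobenius_def, ← hcard, FiniteField.pow_card, RingHom.id_apply]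
  have key := MvPowerSeries.map_iterateFrobenius_expand p hprime.ne_zero (f := g) n
  rw [hid, MvPowerSeries.map_id, RingHom.id_apply] at key
  rw [Nat.card_eq_fintype_card, hcard, ← PowerSeries.expand_apply (p ^ (n : ℕ))
    (pow_ne_zero _ hprime.ne_zero)]
  exact key

end FiniteField

lemma sub_pow_eq_mul {R : Type*} [CommRing R] (ϖ : R) {n : ℕ} (hn : 2 ≤ n) : ϖ - ϖ ^ n = ϖ * (1 - ϖ ^ (n - 1)) := by
  rw [mul_sub, ← pow_succ', Nat.sub_add_cancel (by omega), mul_one]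

/-! ### The endomorphisms `[a]` and their reduction modulo `ϖ`. -/

namespace IsLubinTate

open PowerSeries IsLocalRing

variable {R : Type*} [CommRing R] [IsLocalRing R] {ϖ : R} {f : PowerSeries R}
  {F : FormalGroup R}

lemma map_residue (hF : IsLubinTate ϖ f F) (hϖ : ∀ x, residue R x = 0 ↔ ϖ ∣ x) :
    f.map (residue R) = X ^ Nat.card (ResidueField R) := by
  ext n
  have h := (hϖ _).mpr (hF.frobenius.congr n)
  rw [map_sub, map_sub, sub_eq_zero] at h
  rw [coeff_map, h, ← coeff_map, map_pow, map_X]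

lemma isUnit_one_sub_pow (hF : IsLubinTate ϖ f F) {n : ℕ} (hn : n ≠ 0) :
    IsUnit (1 - ϖ ^ n) :=
  isUnit_one_sub_self_of_mem_nonunits _ ((mem_maximalIdeal _).mp
    (Ideal.pow_mem_of_mem _ ((mem_maximalIdeal _).mpr hF.irreducible.not_isUnit) n
      (Nat.pos_of_ne_zero hn)))

lemma coeff_one_sub_pow_ne_zero [IsDomain R] (hF : IsLubinTate ϖ f F) (n : ℕ) (hn : 2 ≤ n) :
    coeff 1 f - coeff 1 f ^ n ≠ 0 := by
  rw [hF.frobenius.coeff_one_eq, sub_pow_eq_mul ϖ hn]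
  exact mul_ne_zero hF.irreducible.ne_zero (hF.isUnit_one_sub_pow (by omega)).ne_zero

/-- Modulo `ϖ`, `f` becomes `X ^ q`, so `g ∘ f` and `f ∘ g` reduce to `g(X ^ q)` and `g(X) ^ q`,
which agree. The right side is thus divisible by `ϖ`, and `ϖ - ϖ ^ n` is `ϖ` times a unit. -/
lemma exists_mul_eq_coeff [Finite (ResidueField R)] (hF : IsLubinTate ϖ f F)
    (hϖ : ∀ x, residue R x = 0 ↔ ϖ ∣ x) (n : ℕ) (hn : 2 ≤ n) (g : PowerSeries R)
    (hg : constantCoeff g = 0) :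
    ∃ x, (coeff 1 f - coeff 1 f ^ n) * x = coeff n (g.subst f - f.subst g) := by
  have hq : Nat.card (ResidueField R) ≠ 0 := Nat.card_pos.ne'
  have sf : HasSubst f := HasSubst.of_constantCoeff_zero' hF.frobenius.constantCoeff_eq
  have sg : HasSubst g := HasSubst.of_constantCoeff_zero' hg
  have smg : HasSubst (g.map (residue R)) :=
    HasSubst.of_constantCoeff_zero' (by
      rw [← coeff_zero_eq_constantCoeff_apply, coeff_map, coeff_zero_eq_constantCoeff_apply, hg,
        map_zero])
  have h0 : PowerSeries.map (residue R) (g.subst f - f.subst g) = 0 := by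
    rw [map_sub, map_subst_powerSeries _ sf, map_subst_powerSeries _ sg, hF.map_residue hϖ, FiniteField.subst_X_pow_card, subst_pow smg,
      subst_X smg, sub_self]
  obtain ⟨y, hy⟩ := (hϖ (coeff n (g.subst f - f.subst g))).mp (by rw [← coeff_map, h0, map_zero])
  obtain ⟨u, hu⟩ := hF.isUnit_one_sub_pow (n := n - 1) (by omega)
  refine ⟨↑u⁻¹ * y, ?_⟩
  rw [hF.frobenius.coeff_one_eq, sub_pow_eq_mul ϖ hn, ← hu, hy, mul_assoc, Units.mul_inv_cancel_left]

variable [IsDomain R]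

/-- A series that commutes with `f` is an endomorphism of the Lubin-Tate formal group. -/
lemma isBracket_of_commute (hF : IsLubinTate ϖ f F) {a : R} {g : PowerSeries R}
    (hg : constantCoeff g = 0) (ha : coeff 1 g = a) (hc : f.subst g = g.subst f) :
    IsBracket f F a g := by
  refine ⟨⟨hg, ?_⟩, ha, hc⟩
  have hf := hF.frobenius.constantCoeff_eq
  have hX (i : Fin 2) (h : PowerSeries R) (h0 : constantCoeff h = 0) :
      MvPowerSeries.constantCoeff
        (h.subst (MvPowerSeries.X i : MvPowerSeries (Fin 2) R)) = 0 :=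
    constantCoeff_subst_eq_zero (by simp) h h0
  have sF : PowerSeries.HasSubst F.toPowerSeries :=
    HasSubst.of_constantCoeff_zero F.zero_constantCoeff
  have sf : HasSubst f := HasSubst.of_constantCoeff_zero' hf
  have sg : HasSubst g := HasSubst.of_constantCoeff_zero' hg
  have sfX : MvPowerSeries.HasSubst fun i =>
      (f.subst (MvPowerSeries.X i : MvPowerSeries (Fin 2) R) : MvPowerSeries (Fin 2) R) :=
    MvPowerSeries.hasSubst_of_constantCoeff_zero fun i => hX i f hf
  have hpair : ![f.subst (MvPowerSeries.X 0 : MvPowerSeries (Fin 2) R),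
      f.subst (MvPowerSeries.X 1 : MvPowerSeries (Fin 2) R)] = fun i =>
      (f.subst (MvPowerSeries.X i : MvPowerSeries (Fin 2) R) : MvPowerSeries (Fin 2) R) := by
    funext i
    fin_cases i <;> rfl
  have hfF := hF.isEndomorphism.map_add
  rw [hpair] at hfF
  -- `g(F(X, Y))` and `F(g(X), g(Y))` both commute with `f` and have linear part `a X + a Y`, so
  -- two-variable uniqueness applies.
  refine MvPowerSeries.eq_of_commute hf hF.coeff_one_sub_pow_ne_zero
    (constantCoeff_subst_eq_zero F.zero_constantCoeff g hg)
    (F.constantCoeff_subst_pair (hX 0 g hg) (hX 1 g hg)) ?_ ?_ ?_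
  · intro i
    have hl := MvPowerSeries.coeff_subst_sub_coeff_subst g (e := Finsupp.single i 1)
      F.zero_constantCoeff (map_zero _) (by
        rw [Finsupp.degree_single, sub_zero, Nat.cast_one,
          MvPowerSeries.one_le_order_iff_constCoeff_eq_zero]
        exact F.zero_constantCoeff)
    rw [PowerSeries.subst_zero_of_constantCoeff_zero hg, map_zero, sub_zero, sub_zero] at hl
    rw [hl, F.coeff_subst_pair (hX 0 g hg) (hX 1 g hg), PowerSeries.coeff_subst_single,
      PowerSeries.coeff_subst_single]
    · fin_cases i
      · simp [F.lin_coeff_X]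
      · simp [F.lin_coeff_Y]
    · rw [Finsupp.degree_single, Nat.cast_one, MvPowerSeries.one_le_order_iff_constCoeff_eq_zero]
      exact hX 1 g hg
  · rw [← subst_comp_subst_apply sg sF, hc, subst_comp_subst_apply sf sF, hfF]
    conv_rhs => rw [PowerSeries.subst, MvPowerSeries.subst_comp_subst_apply sF.const sfX]
    rfl
  · rw [hF.isEndomorphism.subst_pair (hX 0 g hg) (hX 1 g hg),
      MvPowerSeries.subst_comp_subst_apply
        (FormalGroup.hasSubst_pair (hX 0 g hg) (hX 1 g hg)) sfX]
    congr 1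
    funext i
    have hcX (i : Fin 2) : f.subst (g.subst (MvPowerSeries.X i : MvPowerSeries (Fin 2) R)) =
        MvPowerSeries.subst (fun i =>
          (f.subst (MvPowerSeries.X i : MvPowerSeries (Fin 2) R) : MvPowerSeries (Fin 2) R))
          (g.subst (MvPowerSeries.X i : MvPowerSeries (Fin 2) R)) := by
      rw [← subst_comp_subst_apply sg (HasSubst.X i), hc, subst_comp_subst_apply sf (HasSubst.X i)]
      conv_rhs => rw [PowerSeries.subst,
        MvPowerSeries.subst_comp_subst_apply (HasSubst.X i).const sfX]
      simp_rw [MvPowerSeries.subst_X sfX]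
      rfl
    fin_cases i
    · exact hcX 0
    · exact hcX 1

lemma isBracket_unique (hF : IsLubinTate ϖ f F) {a : R} {g h : PowerSeries R}
    (hg : IsBracket f F a g) (hh : IsBracket f F a h) : g = h :=
  PowerSeries.eq_of_commute hF.frobenius.constantCoeff_eq hF.coeff_one_sub_pow_ne_zero
    hg.isEndomorphism.constantCoeff_eq hh.isEndomorphism.constantCoeff_eq
    (hg.coeff_one_eq.trans hh.coeff_one_eq.symm) hg.commute hh.commute

theorem existsUnique_isBracket [Finite (ResidueField R)] (hF : IsLubinTate ϖ f F)
    (hϖ : ∀ x, residue R x = 0 ↔ ϖ ∣ x) (a : R) :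
    ∃! g : PowerSeries R, IsBracket f F a g := by
  obtain ⟨g, hg, ha, hc⟩ := exists_commute hF.frobenius.constantCoeff_eq
    (hF.exists_mul_eq_coeff hϖ) a
  exact ⟨g, hF.isBracket_of_commute hg ha hc, fun h hh =>
    hF.isBracket_unique hh (hF.isBracket_of_commute hg ha hc)⟩

lemma isBracket_bracket [Finite (ResidueField R)] (hF : IsLubinTate ϖ f F)
    (hϖ : ∀ x, residue R x = 0 ↔ ϖ ∣ x) (a : R) : IsBracket f F a (bracket f F a) :=
  Classical.epsilon_spec (hF.existsUnique_isBracket hϖ a).exists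

/-- `F(g, h)` commutes with `f` because `f` is an endomorphism of `F`. With uniqueness this gives
`[a + b] = F([a], [b])`. -/
lemma isBracket_add (hF : IsLubinTate ϖ f F) {a b : R} {g h : PowerSeries R}
    (hg : IsBracket f F a g) (hh : IsBracket f F b h) :
    IsBracket f F (a + b) (F.toPowerSeries.subst ![g, h] : MvPowerSeries Unit R) := by
  have g0 : MvPowerSeries.constantCoeff g = 0 := hg.isEndomorphism.constantCoeff_eq
  have h0 : MvPowerSeries.constantCoeff h = 0 := hh.isEndomorphism.constantCoeff_eq
  have sf : HasSubst f := HasSubst.of_constantCoeff_zero' hF.frobenius.constantCoeff_eq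
  refine hF.isBracket_of_commute (F.constantCoeff_subst_pair g0 h0) ?_ ?_
  · have := F.coeff_subst_pair g0 h0 (e := Finsupp.single () 1) (by
      rw [Finsupp.degree_single, Nat.cast_one, MvPowerSeries.one_le_order_iff_constCoeff_eq_zero]
      exact h0)
    refine this.trans ?_
    rw [← hg.coeff_one_eq, ← hh.coeff_one_eq]
    rfl
  · rw [hF.isEndomorphism.subst_pair g0 h0]
    conv_rhs => rw [PowerSeries.subst,
      MvPowerSeries.subst_comp_subst_apply (FormalGroup.hasSubst_pair g0 h0) sf.const]
    congr 1
    funext i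
    fin_cases i
    · exact hg.commute
    · exact hh.commute

lemma isBracket_subst (hF : IsLubinTate ϖ f F) {a : R} {g : PowerSeries R}
    (hg : IsBracket f F a g) : IsBracket f F (ϖ * a) (g.subst f) := by
  have g0 := hg.isEndomorphism.constantCoeff_eq
  have f0 := hF.frobenius.constantCoeff_eq
  have sf : HasSubst f := HasSubst.of_constantCoeff_zero' f0
  have sg : HasSubst g := HasSubst.of_constantCoeff_zero' g0
  refine hF.isBracket_of_commute (constantCoeff_subst_zero f0 g0) ?_ ?_
  · rw [coeff_one_subst f0 g0, hF.frobenius.coeff_one_eq, hg.coeff_one_eq]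
  · rw [← hg.commute, subst_comp_subst_apply sg sf, ← hg.commute]

/-- Modulo `ϖ`, the series `[ϖ ^ n a](X)` is `[a](X ^ (q ^ n))`. -/
lemma map_residue_bracket_pow_mul [Finite (ResidueField R)] (hF : IsLubinTate ϖ f F)
    (hϖ : ∀ x, residue R x = 0 ↔ ϖ ∣ x) (a : R) (n : ℕ) :
    (bracket f F (ϖ ^ n * a)).map (residue R) =
      expand (Nat.card (ResidueField R) ^ n) (pow_ne_zero _ Nat.card_pos.ne')
        ((bracket f F a).map (residue R)) := by
  have sf : HasSubst f := HasSubst.of_constantCoeff_zero' hF.frobenius.constantCoeff_eq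
  induction n with
  | zero => simp
  | succ n ih =>
    have h1 : bracket f F (ϖ ^ (n + 1) * a) = (bracket f F (ϖ ^ n * a)).subst f := by
      refine hF.isBracket_unique (hF.isBracket_bracket hϖ _) ?_
      rw [pow_succ', mul_assoc]
      exact hF.isBracket_subst (hF.isBracket_bracket hϖ _)
    rw [h1, map_subst_powerSeries _ sf, ih, hF.map_residue hϖ, ← expand_apply _ Nat.card_pos.ne', ← expand_mul]
    simp only [pow_succ']

/-- The function `C_{q ^ n}` modulo `ϖ` on a coset of `ϖ ^ n`. -/
theorem residue_coefficientFunction_add [Finite (ResidueField R)] (hF : IsLubinTate ϖ f F)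
    (hϖ : ∀ x, residue R x = 0 ↔ ϖ ∣ x) (a b : R) (n : ℕ) :
    residue R (coefficientFunction f F (Nat.card (ResidueField R) ^ n) (a + ϖ ^ n * b)) =
      residue R (coefficientFunction f F (Nat.card (ResidueField R) ^ n) a) + residue R b := by
  set q := Nat.card (ResidueField R) with hq
  have hqn : q ^ n ≠ 0 := pow_ne_zero _ Nat.card_pos.ne'
  have ha := hF.isBracket_bracket hϖ a
  have hb := hF.isBracket_bracket hϖ (ϖ ^ n * b)
  have a0 : MvPowerSeries.constantCoeff (bracket f F a) = 0 := ha.isEndomorphism.constantCoeff_eq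
  have b0 : MvPowerSeries.constantCoeff (bracket f F (ϖ ^ n * b)) = 0 :=
    hb.isEndomorphism.constantCoeff_eq
  have hadd := hF.isBracket_unique (hF.isBracket_bracket hϖ _) (hF.isBracket_add ha hb)
  have hmap : PowerSeries.map (residue R) (bracket f F (a + ϖ ^ n * b)) =
      ((F.map (residue R)).toPowerSeries.subst ![PowerSeries.map (residue R) (bracket f F a),
        PowerSeries.map (residue R) (bracket f F (ϖ ^ n * b))] :
        MvPowerSeries Unit (ResidueField R)) := by
    rw [hadd]
    refine (MvPowerSeries.map_subst (FormalGroup.hasSubst_pair a0 b0) _).trans ?_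
    rw [FormalGroup.map_toPowerSeries]
    congr 1
    funext i
    fin_cases i <;> rfl
  have map0 {g : PowerSeries R} (h : MvPowerSeries.constantCoeff g = 0) :
      MvPowerSeries.constantCoeff (PowerSeries.map (residue R) g) = 0 := by
    rw [PowerSeries.map, MvPowerSeries.constantCoeff_map, h, map_zero]
  have hexp := hF.map_residue_bracket_pow_mul hϖ b n
  -- Up to degree `q ^ n`, `[b](X ^ (q ^ n))` is just `b X ^ (q ^ n)`, so adding it in `F` is
  -- ordinary addition in that degree.
  have hcoef (m : ℕ) (hm : m ≤ q ^ n) :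
      coeff m (PowerSeries.map (residue R) (bracket f F (ϖ ^ n * b))) =
        if m = q ^ n then residue R b else 0 := by
    rw [hexp, coeff_expand]
    split_ifs with h1 h2 h2
    · rw [h2, Nat.div_self (Nat.pos_of_ne_zero hqn), coeff_map,
        (hF.isBracket_bracket hϖ b).coeff_one_eq]
    · have : m = 0 := by
        by_contra h
        exact h2 (le_antisymm hm (Nat.le_of_dvd (Nat.pos_of_ne_zero h) h1))
      rw [this, Nat.zero_div, coeff_map, coeff_zero_eq_constantCoeff_apply,
        (hF.isBracket_bracket hϖ b).isEndomorphism.constantCoeff_eq, map_zero]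
    · exact absurd (h2 ▸ dvd_rfl) h1
    · rfl
  have hord : ((q ^ n : ℕ) : ℕ∞) ≤
      MvPowerSeries.order (PowerSeries.map (residue R) (bracket f F (ϖ ^ n * b))) :=
    nat_le_mvOrder fun m hm => by rw [hcoef m hm.le, if_neg hm.ne]
  have key := (F.map (residue R)).coeff_subst_pair (map0 a0) (map0 b0)
    (e := Finsupp.single () (q ^ n)) (by rwa [Finsupp.degree_single])
  rw [← hmap] at key
  have hb' := hcoef (q ^ n) le_rfl
  rw [if_pos rfl] at hb'
  simp only [coefficientFunction, ← coeff_map]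
  rw [← hb']
  exact key

end IsLubinTate

lemma Finset.sum_range_mul_eq {M : Type*} [AddCommMonoid M] (G : ℕ → M) (a t : ℕ) :
    ∑ m ∈ range (a * t), G m = ∑ i ∈ range t, ∑ m ∈ range a, G (a * i + m) := by
  induction t with
  | zero => simp
  | succ t ih => rw [mul_add_one, sum_range_add, ih, sum_range_succ]

/-! ### Products indexed by `q`-digits. -/

section digitExtension

variable {A : Type*} [CommMonoid A] {q : ℕ}

lemma digitExtension_eq_prod (hq : 2 ≤ q) (e : ℕ → A) {m n : ℕ} (hm : m < q ^ n) :
    digitExtension q e m = ∏ j ∈ Finset.range n, e j ^ (m / q ^ j % q) := by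
  rw [digitExtension]
  simp_rw [← Nat.getD_digits m _ hq]
  refine Finset.prod_subset (Finset.range_subset_range.mpr
    ((Nat.digits_length_le_iff (by omega) m).mpr hm)) fun j _ hj => ?_
  rw [Finset.mem_range, not_lt] at hj
  rw [List.getD_eq_default _ _ hj, pow_zero]

/-- Splitting off the top digit drives both inductions of the digit principle. -/
lemma digitExtension_pow_mul_add (hq : 2 ≤ q) (e : ℕ → A) {m n i : ℕ} (hm : m < q ^ n)
    (hi : i < q) : digitExtension q e (q ^ n * i + m) = digitExtension q e m * e n ^ i := by
  have hlt : q ^ n * i + m < q ^ (n + 1) := by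
    calc q ^ n * i + m < q ^ n * i + q ^ n := by omega
      _ = q ^ n * (i + 1) := by ring
      _ ≤ q ^ n * q := Nat.mul_le_mul_left _ hi
      _ = q ^ (n + 1) := (pow_succ _ _).symm
  have hpos (j : ℕ) : 0 < q ^ j := Nat.pow_pos (by omega)
  rw [digitExtension_eq_prod hq e hlt, digitExtension_eq_prod hq e hm, Finset.prod_range_succ]
  congr 1
  · refine Finset.prod_congr rfl fun j hj => ?_
    obtain ⟨c, rfl⟩ := Nat.exists_eq_add_of_lt (Finset.mem_range.mp hj)
    rw [show q ^ (j + c + 1) * i + m = q ^ j * (q * (q ^ c * i)) + m by ring,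
      Nat.mul_add_div (hpos j), Nat.mul_add_mod]
  · rw [Nat.mul_add_div (hpos n), Nat.div_eq_of_lt hm, add_zero, Nat.mod_eq_of_lt hi]

lemma map_digitExtension {B : Type*} [CommMonoid B] {G : Type*} [FunLike G A B]
    [MonoidHomClass G A B] (φ : G) (e : ℕ → A) (m : ℕ) :
    φ (digitExtension q e m) = digitExtension q (fun j => φ (e j)) m := by
  simp only [digitExtension, map_prod, map_pow]

end digitExtension

/-! ### The digit principle over the residue field. -/

namespace DigitPrinciple

variable {R k : Type*} [CommRing R] [Field k] {res : R →+* k} {ϖ : R} {e : ℕ → R → k}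

lemma apply_add_pow_mul (hϖ : res ϖ = 0)
    (he : ∀ n a b, e n (a + ϖ ^ n * b) = e n a + res b) {j n : ℕ} (h : j < n) (a b : R) :
    e j (a + ϖ ^ n * b) = e j a := by
  obtain ⟨c, rfl⟩ := Nat.exists_eq_add_of_lt h
  rw [show ϖ ^ (j + c + 1) * b = ϖ ^ j * (ϖ * (ϖ ^ c * b)) by ring, he, map_mul, hϖ, zero_mul,
    add_zero]

lemma digitExtension_add_pow_mul {q : ℕ} (hq : 2 ≤ q) (hϖ : res ϖ = 0)
    (he : ∀ n a b, e n (a + ϖ ^ n * b) = e n a + res b) {m n : ℕ} (hm : m < q ^ n) (a b : R) :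
    digitExtension q (fun j => e j (a + ϖ ^ n * b)) m = digitExtension q (fun j => e j a) m := by
  rw [digitExtension_eq_prod hq _ hm, digitExtension_eq_prod hq _ hm]
  exact Finset.prod_congr rfl fun j hj => by
    rw [apply_add_pow_mul hϖ he (Finset.mem_range.mp hj)]

variable [Finite k]

/-- The functions `digitExtension q e m` with `m < q ^ n` are linearly independent. -/
theorem eq_zero_of_sum_eq_zero (hres : Function.Surjective res) (hϖ : res ϖ = 0)
    (he : ∀ n a b, e n (a + ϖ ^ n * b) = e n a + res b) (n : ℕ) :
    ∀ c : ℕ → k, (∀ a, ∑ m ∈ Finset.range (Nat.card k ^ n),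
      c m * digitExtension (Nat.card k) (fun j => e j a) m = 0) →
      ∀ m < Nat.card k ^ n, c m = 0 := by
  have := Fintype.ofFinite k
  have hq : 2 ≤ Nat.card k := Finite.one_lt_card
  have hcard : Nat.card k = (Finset.univ : Finset k).card := by
    rw [Nat.card_eq_fintype_card, Finset.card_univ]
  set q := Nat.card k
  induction n with
  | zero =>
    intro c hc m hm
    have h1 := hc 0
    rw [pow_zero, Finset.sum_range_one, digitExtension_eq_prod hq _ (n := 0) (by simp),
      Finset.prod_range_zero, mul_one] at h1
    rw [pow_zero, Nat.lt_one_iff] at hm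
    rw [hm, h1]
  | succ n ih =>
    intro c hc
    -- For fixed `a`, moving along `a + ϖ ^ n * b` freezes the lower functions while `e n` runs
    -- through all of `k`. The relation becomes a polynomial of degree `< q` with `q` roots.
    have hS : ∀ i < q, ∀ a, ∑ m ∈ Finset.range (q ^ n),
        c (q ^ n * i + m) * digitExtension q (fun j => e j a) m = 0 := by
      intro i hi a
      set S : ℕ → k := fun i => ∑ m ∈ Finset.range (q ^ n),
        c (q ^ n * i + m) * digitExtension q (fun j => e j a) m with hSdef
      set p : Polynomial k := ∑ i ∈ Finset.range q, Polynomial.monomial i (S i) with hp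
      have hp0 : p = 0 := by
        refine Polynomial.eq_zero_of_degree_lt_of_eval_finset_eq_zero Finset.univ ?_ ?_
        · rw [← hcard]
          refine (Polynomial.degree_sum_le _ _).trans_lt
            ((Finset.sup_lt_iff (WithBot.bot_lt_coe q)).mpr fun i hi => ?_)
          exact (Polynomial.degree_monomial_le _ _).trans_lt
            (Nat.cast_lt.mpr (Finset.mem_range.mp hi))
        · intro t _
          obtain ⟨b, hb⟩ := hres (t - e n a)
          rw [hp, Polynomial.eval_finsetSum]
          simp only [Polynomial.eval_monomial]
          rw [← hc (a + ϖ ^ n * b), pow_succ, Finset.sum_range_mul_eq]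
          refine Finset.sum_congr rfl fun i hi => ?_
          rw [hSdef, Finset.sum_mul]
          refine Finset.sum_congr rfl fun m hm => ?_
          rw [digitExtension_pow_mul_add hq _ (Finset.mem_range.mp hm) (Finset.mem_range.mp hi),
            digitExtension_add_pow_mul hq hϖ he (Finset.mem_range.mp hm), he, hb,
            add_sub_cancel, mul_assoc]
      have := congrArg (Polynomial.coeff · i) hp0
      simpa [hp, Polynomial.finsetSum_coeff, Polynomial.coeff_monomial, hi] using this
    intro m hm
    have hdiv : m / q ^ n < q := Nat.div_lt_of_lt_mul (by rwa [← pow_succ])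
    have := ih _ (hS _ hdiv) (m % q ^ n) (Nat.mod_lt _ (Nat.pow_pos (by omega)))
    rwa [Nat.div_add_mod] at this

/-- The functions `digitExtension q e m` with `m < q ^ n` span the functions that are constant on
the cosets of `ϖ ^ n`. -/
theorem exists_eq_sum (hres : Function.Surjective res) (hϖ : ∀ x, res x = 0 ↔ ϖ ∣ x)
    (he : ∀ n a b, e n (a + ϖ ^ n * b) = e n a + res b) (n : ℕ) :
    ∀ g : R → k, (∀ a b, g (a + ϖ ^ n * b) = g a) → ∃ c : ℕ → k, ∀ a,
      g a = ∑ m ∈ Finset.range (Nat.card k ^ n),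
        c m * digitExtension (Nat.card k) (fun j => e j a) m := by
  classical
  have := Fintype.ofFinite k
  have hq : 2 ≤ Nat.card k := Finite.one_lt_card
  have hcard : Nat.card k = (Finset.univ : Finset k).card := by
    rw [Nat.card_eq_fintype_card, Finset.card_univ]
  set q := Nat.card k
  induction n with
  | zero =>
    refine fun g hg => ⟨fun _ => g 0, fun a => ?_⟩
    rw [pow_zero, Finset.sum_range_one, digitExtension_eq_prod hq _ (n := 0) (by simp),
      Finset.prod_range_zero, mul_one]
    simpa using hg 0 a
  | succ n ih =>
    intro g hg
    have hcongr (a b b' : R) (h : res b = res b') : g (a + ϖ ^ n * b) = g (a + ϖ ^ n * b') := by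
      obtain ⟨y, hy⟩ := (hϖ (b - b')).mp (by rw [map_sub, h, sub_self])
      rw [← hg (a + ϖ ^ n * b') y]
      congr 1
      linear_combination ϖ ^ n * hy
    set s := Function.surjInv hres
    have hs : ∀ t, res (s t) = t := Function.surjInv_eq hres
    -- `G a t` is the value of `g` at the points of the coset of `a` modulo `ϖ ^ n` where `e n`
    -- equals `t`. It depends only on the coset, so the induction hypothesis applies to each
    -- coefficient of the interpolating polynomial `p a`.
    set G : R → k → k := fun a t => g (a + ϖ ^ n * s (t - e n a)) with hG
    set p : R → Polynomial k := fun a => Lagrange.interpolate Finset.univ id (G a) with hp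
    have hGconst (a b : R) : G (a + ϖ ^ n * b) = G a := by
      funext t
      simp only [hG]
      rw [add_assoc, ← mul_add]
      refine hcongr _ _ _ ?_
      rw [map_add, hs, hs, he]
      ring
    choose c hc using fun i => ih (fun a => (p a).coeff i) fun a b => by
      simp only [hp, hGconst]
    refine ⟨fun m => c (m / q ^ n) (m % q ^ n), fun a => ?_⟩
    have heval : g a = (p a).eval (e n a) := by
      have := Lagrange.eval_interpolate_at_node (s := Finset.univ) (v := id) (G a)
        Function.injective_id.injOn (Finset.mem_univ (e n a))
      rw [id] at this
      rw [hp, this, hG]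
      simp only [sub_self]
      rw [hcongr a (s 0) 0 (by rw [hs, map_zero]), mul_zero, add_zero]
    have hdeg : (p a).degree < q := by
      rw [hcard]
      exact Lagrange.degree_interpolate_lt _ Function.injective_id.injOn
    have hdeg' : (p a).natDegree < q := by
      rcases eq_or_ne (p a) 0 with h0 | h0
      · rw [h0, Polynomial.natDegree_zero]
        omega
      · exact (Polynomial.natDegree_lt_iff_degree_lt h0).mpr hdeg
    rw [heval, Polynomial.eval_eq_sum_range' hdeg', pow_succ, Finset.sum_range_mul_eq]
    refine Finset.sum_congr rfl fun i hi => ?_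
    rw [hc, Finset.sum_mul]
    refine Finset.sum_congr rfl fun m hm => ?_
    have hm' := Finset.mem_range.mp hm
    dsimp only
    rw [digitExtension_pow_mul_add hq _ hm' (Finset.mem_range.mp hi),
      Nat.mul_add_div (Nat.pow_pos (by omega)), Nat.div_eq_of_lt hm', add_zero, Nat.mul_add_mod,
      Nat.mod_eq_of_lt hm', mul_assoc]

end DigitPrinciple

/-! ### Norms and residues in the ring of integers. -/

namespace IntegerRing

variable {K : Type*} [NontriviallyNormedField K] [IsUltrametricDist K]

lemma norm_le_one (a : IntegerRing K) : ‖(a : K)‖ ≤ 1 := Valued.integer.norm_le_one a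

lemma mem_iff {x : K} : x ∈ IntegerRing K ↔ ‖x‖ ≤ 1 := Valued.integer.mem_iff

lemma residue_eq_zero_iff_norm_lt_one {a : IntegerRing K} :
    IsLocalRing.residue (IntegerRing K) a = 0 ↔ ‖(a : K)‖ < 1 := by
  rw [IsLocalRing.residue_eq_zero_iff, IsLocalRing.mem_maximalIdeal, mem_nonunits_iff,
    (norm_le_one a).lt_iff_ne]
  exact not_congr Valued.integer.isUnit_iff_norm_eq_one

lemma norm_lt_one_of_irreducible {ϖ : IntegerRing K} (hϖ : Irreducible ϖ) : ‖(ϖ : K)‖ < 1 :=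
  Valued.integer.norm_irreducible_lt_one hϖ

lemma dvd_iff_norm_le {a b : IntegerRing K} : a ∣ b ↔ ‖(b : K)‖ ≤ ‖(a : K)‖ := by
  constructor
  · rintro ⟨c, rfl⟩
    rw [Subring.coe_mul, norm_mul]
    exact mul_le_of_le_one_right (norm_nonneg _) (norm_le_one c)
  · intro h
    rcases eq_or_ne (a : K) 0 with h0 | h0
    · rw [h0, norm_zero, norm_le_zero_iff] at h
      rw [Subtype.ext (a1 := b) (a2 := 0) h]
      exact dvd_zero a
    · have hm : (b : K) / a ∈ IntegerRing K := by
        rw [mem_iff, norm_div]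
        exact div_le_one_of_le₀ h (norm_nonneg _)
      exact ⟨⟨_, hm⟩, Subtype.ext (mul_div_cancel₀ _ h0).symm⟩

/-- Divisibility is comparison of norms. If `ϖ` does not divide `a`, then `a` divides `ϖ` with
strictly larger norm, so the cofactor is not a unit and irreducibility makes `a` one. -/
lemma residue_eq_zero_iff_dvd {ϖ : IntegerRing K} (hϖ : Irreducible ϖ) (a : IntegerRing K) :
    IsLocalRing.residue (IntegerRing K) a = 0 ↔ ϖ ∣ a := by
  rw [residue_eq_zero_iff_norm_lt_one]
  refine ⟨fun h => ?_, fun h => (dvd_iff_norm_le.mp h).trans_lt (norm_lt_one_of_irreducible hϖ)⟩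
  by_contra hd
  rw [dvd_iff_norm_le, not_le] at hd
  obtain ⟨c, hc⟩ := dvd_iff_norm_le.mpr hd.le
  rcases hϖ.isUnit_or_isUnit hc with hu | hu
  · exact h.ne (Valued.integer.isUnit_iff_norm_eq_one.mp hu)
  · have h1 : ‖(c : K)‖ = 1 := Valued.integer.isUnit_iff_norm_eq_one.mp hu
    rw [hc, Subring.coe_mul, norm_mul, h1, mul_one] at hd
    exact lt_irrefl _ hd

lemma norm_le_of_norm_lt_one {ϖ : IntegerRing K} (hϖ : Irreducible ϖ) {x : K} (hx : ‖x‖ < 1) :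
    ‖x‖ ≤ ‖(ϖ : K)‖ :=
  dvd_iff_norm_le.mp ((residue_eq_zero_iff_dvd hϖ ⟨x, mem_iff.mpr hx.le⟩).mp
    (residue_eq_zero_iff_norm_lt_one.mpr hx))

lemma residue_eq_of_norm_sub_lt_one {a b : IntegerRing K} (h : ‖(a : K) - b‖ < 1) :
    IsLocalRing.residue (IntegerRing K) a = IsLocalRing.residue (IntegerRing K) b := by
  rw [← sub_eq_zero, ← map_sub, residue_eq_zero_iff_norm_lt_one]
  exact h

variable [LocallyCompactSpace K]

/-- The residue map is locally constant on a compact space, so its range is finite. -/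
instance : Finite (IsLocalRing.ResidueField (IntegerRing K)) := by
  have hlc : IsLocallyConstant (IsLocalRing.residue (IntegerRing K)) :=
    (IsLocallyConstant.iff_eventually_eq _).mpr fun a =>
      Metric.eventually_nhds_iff.mpr ⟨1, one_pos, fun b hb =>
        residue_eq_of_norm_sub_lt_one (by rwa [Subtype.dist_eq, dist_eq_norm] at hb)⟩
  have := hlc.range_finite
  rw [IsLocalRing.residue_surjective.range_eq] at this
  exact Set.finite_univ_iff.mp this

end IntegerRing

lemma exists_forall_norm_le_norm {E : Type*} [NormedAddCommGroup E] {c : ℕ → E} (hc : Tendsto c atTop (𝓝 0)) :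
    ∃ m₀, ∀ m, ‖c m‖ ≤ ‖c m₀‖ := by
  by_cases h : ∀ m, c m = 0
  · exact ⟨0, fun m => by rw [h m, h 0]⟩
  · push Not at h
    obtain ⟨m₁, h₁⟩ := h
    have hev := (tendsto_zero_iff_norm_tendsto_zero.mp hc).eventually_lt_const
      (norm_pos_iff.mpr h₁)
    obtain ⟨N, hN⟩ := eventually_atTop.mp hev
    obtain ⟨m₀, -, hm₀⟩ := Finset.exists_max_image (Finset.range (max N m₁ + 1)) (fun m => ‖c m‖)
      ⟨m₁, Finset.mem_range.mpr (by omega)⟩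
    refine ⟨m₀, fun m => ?_⟩
    rcases lt_or_ge m (max N m₁ + 1) with hm | hm
    · exact hm₀ m (Finset.mem_range.mpr hm)
    · exact (hN m (by omega)).le.trans (hm₀ m₁ (Finset.mem_range.mpr (by omega)))

lemma sum_smul_apply {K : Type*} [NontriviallyNormedField K] [IsUltrametricDist K]
    {E : ℕ → C(IntegerRing K, K)} {ε : ℕ → IntegerRing K → IntegerRing K}
    (hE : ∀ m a, E m a = (ε m a : K)) (s : Finset ℕ) (d : ℕ → IntegerRing K)
    (a : IntegerRing K) :
    (∑ m ∈ s, (d m : K) • E m) a = ((∑ m ∈ s, d m * ε m a : IntegerRing K) : K) := by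
  simp [hE]

/-! ### From reductions to an orthonormal basis. -/

section Orthonormal

open IsLocalRing

variable {K : Type*} [NontriviallyNormedField K] [IsUltrametricDist K] [LocallyCompactSpace K]
  {E : ℕ → C(IntegerRing K, K)} {ε : ℕ → IntegerRing K → IntegerRing K} {q : ℕ}
  {ϖ : IntegerRing K}

lemma norm_le_one_of_coe_eq (hE : ∀ m a, E m a = (ε m a : K)) (m : ℕ) : ‖E m‖ ≤ 1 :=
  (ContinuousMap.norm_le _ zero_le_one).mpr fun a => by
    rw [hE]
    exact IntegerRing.norm_le_one _

lemma summable_smul_of_tendsto (hE : ∀ m a, E m a = (ε m a : K)) {c : ℕ → K}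
    (hc : Tendsto c atTop (𝓝 0)) : Summable fun m => c m • E m := by
  have : ProperSpace K :=
    ProperSpace.of_nontriviallyNormedField_of_weaklyLocallyCompactSpace K
  refine NonarchimedeanAddGroup.summable_of_tendsto_cofinite_zero ?_
  rw [Nat.cofinite_eq_atTop]
  refine squeeze_zero_norm (fun m => ?_) (tendsto_zero_iff_norm_tendsto_zero.mp hc)
  rw [norm_smul]
  exact mul_le_of_le_one_right (norm_nonneg _) (norm_le_one_of_coe_eq hE m)

lemma norm_le_of_hasSum_smul (hE : ∀ m a, E m a = (ε m a : K)) {c : ℕ → K} {r : ℝ}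
    (hr : ∀ m, ‖c m‖ ≤ r) {x : C(IntegerRing K, K)} (hx : HasSum (fun m => c m • E m) x) :
    ‖x‖ ≤ r := by
  rw [← hx.tsum_eq]
  refine IsUltrametricDist.norm_tsum_le_of_forall_le fun m => ?_
  rw [norm_smul]
  exact (mul_le_of_le_one_right (norm_nonneg _) (norm_le_one_of_coe_eq hE m)).trans (hr m)

/-- If the reductions of the functions `ε m` are linearly independent, then the norm of
`∑ cₘ Eₘ` is the maximum of the `‖cₘ‖`. -/
theorem isGreatest_norm_of_hasSum_smul (hE : ∀ m a, E m a = (ε m a : K)) (hq : 2 ≤ q)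
    (hind : ∀ n, ∀ c : ℕ → ResidueField (IntegerRing K),
      (∀ a, ∑ m ∈ Finset.range (q ^ n), c m * residue _ (ε m a) = 0) → ∀ m < q ^ n, c m = 0)
    {c : ℕ → K} (hc : Tendsto c atTop (𝓝 0)) {x : C(IntegerRing K, K)}
    (hx : HasSum (fun m => c m • E m) x) : IsGreatest (Set.range fun m => ‖c m‖) ‖x‖ := by
  obtain ⟨m₀, hm₀⟩ := exists_forall_norm_le_norm hc
  have hle : ‖x‖ ≤ ‖c m₀‖ := norm_le_of_hasSum_smul hE hm₀ hx
  suffices hge : ‖c m₀‖ ≤ ‖x‖ by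
    rw [le_antisymm hle hge]
    exact ⟨⟨m₀, rfl⟩, fun _ ⟨m, hm⟩ => hm ▸ hm₀ m⟩
  by_contra! hlt
  have hne : c m₀ ≠ 0 := norm_pos_iff.mp ((norm_nonneg x).trans_lt hlt)
  -- Rescale so that the largest coefficient is `1`; its residue must then not vanish.
  set d : ℕ → IntegerRing K := fun m => ⟨(c m₀)⁻¹ * c m, by
    rw [IntegerRing.mem_iff, norm_mul, norm_inv]
    exact inv_mul_le_one_of_le₀ (hm₀ m) (norm_nonneg _)⟩ with hd
  have hdE : HasSum (fun m => (d m : K) • E m) ((c m₀)⁻¹ • x) := by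
    simpa only [hd, smul_smul] using hx.const_smul (c m₀)⁻¹
  have hy : ‖(c m₀)⁻¹ • x‖ < 1 := by
    rw [norm_smul, norm_inv]
    exact (inv_mul_lt_one₀ (norm_pos_iff.mpr hne)).mpr hlt
  have hdlim : Tendsto (fun m => ‖(d m : K)‖) atTop (𝓝 0) := by
    have := (tendsto_zero_iff_norm_tendsto_zero.mp hc).const_mul ‖c m₀‖⁻¹
    simpa only [hd, norm_mul, norm_inv, mul_zero] using this
  -- Any bound below `1` would do in place of `1/2`: it keeps the tail's norm strictly below `1`, so
  -- the finite head reduces to zero.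
  obtain ⟨N, hN⟩ := eventually_atTop.mp (hdlim.eventually_le_const (one_half_pos (α := ℝ)))
  obtain ⟨n, hn⟩ : ∃ n, max N (m₀ + 1) ≤ q ^ n :=
    ⟨max N (m₀ + 1), (Nat.lt_pow_self (by omega)).le⟩
  have htail := norm_le_of_hasSum_smul (fun m a => hE (m + q ^ n) a)
    (fun m => hN (m + q ^ n) (by omega)) ((hasSum_nat_add_iff' (q ^ n)).mpr hdE)
  have hfin : ‖∑ m ∈ Finset.range (q ^ n), (d m : K) • E m‖ < 1 := by
    rw [← sub_sub_cancel ((c m₀)⁻¹ • x) (∑ m ∈ Finset.range (q ^ n), (d m : K) • E m),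
      sub_eq_add_neg]
    refine (IsUltrametricDist.norm_add_le_max _ _).trans_lt (max_lt hy ?_)
    rw [norm_neg]
    exact htail.trans_lt one_half_lt_one
  have hzero := hind n (fun m => residue _ (d m)) fun a => by
    simp only [← map_mul, ← map_sum]
    rw [IntegerRing.residue_eq_zero_iff_norm_lt_one, ← sum_smul_apply hE]
    exact (ContinuousMap.norm_coe_le_norm _ a).trans_lt hfin
  have h1 := hzero m₀ (by omega)
  rw [IntegerRing.residue_eq_zero_iff_norm_lt_one] at h1
  simp [hd, hne] at h1

/-- Approximation modulo `ϖ` by the span of the functions `E m`. -/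
theorem exists_mem_span_norm_sub_le (hE : ∀ m a, E m a = (ε m a : K)) (hϖ : Irreducible ϖ)
    (hspan : ∀ n, ∀ g : IntegerRing K → ResidueField (IntegerRing K),
      (∀ a b, g (a + ϖ ^ n * b) = g a) → ∃ c : ℕ → ResidueField (IntegerRing K), ∀ a,
        g a = ∑ m ∈ Finset.range (q ^ n), c m * residue _ (ε m a))
    {h : C(IntegerRing K, K)} (hh : ‖h‖ ≤ 1) :
    ∃ g ∈ Submodule.span K (Set.range E), ‖h - g‖ ≤ ‖(ϖ : K)‖ := by
  set η : IntegerRing K → IntegerRing K := fun a =>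
    ⟨h a, IntegerRing.mem_iff.mpr ((ContinuousMap.norm_coe_le_norm h a).trans hh)⟩ with hη
  -- By uniform continuity the residue of `h` is constant on cosets of some `ϖ ^ n`.
  obtain ⟨δ, hδ, hhδ⟩ := Metric.uniformContinuous_iff.mp
    (CompactSpace.uniformContinuous_of_continuous h.continuous) 1 one_pos
  obtain ⟨n, hn⟩ := exists_pow_lt_of_lt_one hδ (IntegerRing.norm_lt_one_of_irreducible hϖ)
  obtain ⟨c, hc⟩ := hspan n (fun a => residue _ (η a)) fun a b => by
    refine IntegerRing.residue_eq_of_norm_sub_lt_one ?_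
    rw [← dist_eq_norm]
    refine hhδ ?_
    rw [Subtype.dist_eq, dist_eq_norm, Subring.coe_add, add_sub_cancel_left, Subring.coe_mul,
      norm_mul, Subring.coe_pow, norm_pow]
    exact (mul_le_of_le_one_right (by positivity) (IntegerRing.norm_le_one b)).trans_lt hn
  choose d hd using fun m => residue_surjective (c m)
  refine ⟨∑ m ∈ Finset.range (q ^ n), (d m : K) • E m, Submodule.sum_mem _ fun m _ =>
    Submodule.smul_mem _ _ (Submodule.subset_span ⟨m, rfl⟩), ?_⟩
  refine (ContinuousMap.norm_le _ (norm_nonneg _)).mpr fun a => ?_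
  refine IntegerRing.norm_le_of_norm_lt_one hϖ ?_
  rw [ContinuousMap.sub_apply, sum_smul_apply hE]
  refine IntegerRing.residue_eq_zero_iff_norm_lt_one
    (a := η a - ∑ m ∈ Finset.range (q ^ n), d m * ε m a).mp ?_
  rw [map_sub, hc a, map_sum, sub_eq_zero]
  simp only [map_mul, hd]

/-- If the reductions of the functions `ε m` span the functions on the quotients of the ring of
integers, then the functions `E m` span a dense subspace. -/
theorem topologicalClosure_span_eq_top (hE : ∀ m a, E m a = (ε m a : K)) (hϖ : Irreducible ϖ)
    (hspan : ∀ n, ∀ g : IntegerRing K → ResidueField (IntegerRing K),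
      (∀ a b, g (a + ϖ ^ n * b) = g a) → ∃ c : ℕ → ResidueField (IntegerRing K), ∀ a,
        g a = ∑ m ∈ Finset.range (q ^ n), c m * residue _ (ε m a)) :
    (Submodule.span K (Set.range E)).topologicalClosure = ⊤ := by
  have hϖ0 : (ϖ : K) ≠ 0 := fun h0 => hϖ.ne_zero (Subtype.ext h0)
  have hpow (n : ℕ) (h : C(IntegerRing K, K)) (hh : ‖h‖ ≤ 1) :
      ∃ g ∈ Submodule.span K (Set.range E), ‖h - g‖ ≤ ‖(ϖ : K)‖ ^ n := by
    induction n with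
    | zero => exact ⟨0, Submodule.zero_mem _, by simpa using hh⟩
    | succ n ih =>
      obtain ⟨g, hg, hgn⟩ := ih
      -- The error, divided by `ϖ ^ n`, is again in the unit ball and can be approximated modulo
      -- `ϖ`.
      obtain ⟨g', hg', hgn'⟩ := exists_mem_span_norm_sub_le hE hϖ hspan
        (h := ((ϖ : K) ^ n)⁻¹ • (h - g)) (by
          rw [norm_smul, norm_inv, norm_pow]
          exact inv_mul_le_one_of_le₀ hgn (by positivity))
      refine ⟨g + (ϖ : K) ^ n • g', Submodule.add_mem _ hg (Submodule.smul_mem _ _ hg'), ?_⟩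
      have : h - (g + (ϖ : K) ^ n • g') =
          (ϖ : K) ^ n • (((ϖ : K) ^ n)⁻¹ • (h - g) - g') := by
        rw [smul_sub, smul_inv_smul₀ (pow_ne_zero n hϖ0), sub_sub]
      rw [this, norm_smul, norm_pow, pow_succ]
      exact mul_le_mul_of_nonneg_left hgn' (by positivity)
  have hball (h : C(IntegerRing K, K)) (hh : ‖h‖ ≤ 1) :
      h ∈ (Submodule.span K (Set.range E)).topologicalClosure := by
    refine Metric.mem_closure_iff.mpr fun r hr => ?_
    obtain ⟨n, hn⟩ := exists_pow_lt_of_lt_one hr (IntegerRing.norm_lt_one_of_irreducible hϖ)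
    obtain ⟨g, hg, hgn⟩ := hpow n h hh
    exact ⟨g, hg, (dist_eq_norm h g).trans_lt (hgn.trans_lt hn)⟩
  refine Submodule.eq_top_iff'.mpr fun h => ?_
  obtain ⟨n, hn⟩ := exists_pow_lt_of_lt_one (x := (‖h‖ + 1)⁻¹) (by positivity)
    (IntegerRing.norm_lt_one_of_irreducible hϖ)
  rw [← inv_smul_smul₀ (pow_ne_zero n hϖ0) h]
  refine Submodule.smul_mem _ _ (hball _ ?_)
  rw [norm_smul, norm_pow]
  calc ‖(ϖ : K)‖ ^ n * ‖h‖ ≤ (‖h‖ + 1)⁻¹ * ‖h‖ :=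
        mul_le_mul_of_nonneg_right hn.le (norm_nonneg h)
    _ ≤ 1 := inv_mul_le_one_of_le₀ (by linarith) (by positivity)

/-- Null sequences form a complete space, so the isometry `c ↦ ∑ cₘ Eₘ` has closed range. The range
contains the dense span, hence is everything; uniqueness is the norm formula applied to the zero
function. -/
theorem isOrthonormalBasis_of_residue (hE : ∀ m a, E m a = (ε m a : K)) (hq : 2 ≤ q)
    (hϖ : Irreducible ϖ)
    (hind : ∀ n, ∀ c : ℕ → ResidueField (IntegerRing K),
      (∀ a, ∑ m ∈ Finset.range (q ^ n), c m * residue _ (ε m a) = 0) → ∀ m < q ^ n, c m = 0)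
    (hspan : ∀ n, ∀ g : IntegerRing K → ResidueField (IntegerRing K),
      (∀ a b, g (a + ϖ ^ n * b) = g a) → ∃ c : ℕ → ResidueField (IntegerRing K), ∀ a,
        g a = ∑ m ∈ Finset.range (q ^ n), c m * residue _ (ε m a)) :
    IsOrthonormalBasis K E := by
  have : ProperSpace K :=
    ProperSpace.of_nontriviallyNormedField_of_weaklyLocallyCompactSpace K
  have hlim (c : ZeroAtInftyContinuousMap ℕ K) : Tendsto c atTop (𝓝 0) :=
    cocompact_eq_atTop (α := ℕ) ▸ ZeroAtInftyContinuousMapClass.zero_at_infty c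
  have hsum (c : ZeroAtInftyContinuousMap ℕ K) := summable_smul_of_tendsto hE (hlim c)
  let T : ZeroAtInftyContinuousMap ℕ K →ₗᵢ[K] C(IntegerRing K, K) :=
    { toFun := fun c => ∑' m, c m • E m
      map_add' := fun c d => by
        rw [← (hsum c).tsum_add (hsum d)]
        simp only [ZeroAtInftyContinuousMap.add_apply, add_smul]
      map_smul' := fun r c => by
        rw [RingHom.id_apply, ← (hsum c).tsum_const_smul r]
        simp only [ZeroAtInftyContinuousMap.smul_apply, smul_assoc]
      norm_map' := fun c => by
        have hg := isGreatest_norm_of_hasSum_smul hE hq hind (hlim c) (hsum c).hasSum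
        change ‖∑' m, c m • E m‖ = ‖c‖
        rw [← ZeroAtInftyContinuousMap.norm_toBCF_eq_norm]
        refine le_antisymm ?_ ?_
        · obtain ⟨m, hm⟩ := hg.1
          rw [← hm]
          exact BoundedContinuousFunction.norm_coe_le_norm c.toBCF m
        · exact (BoundedContinuousFunction.norm_le (norm_nonneg _)).mpr fun m => hg.2 ⟨m, rfl⟩ }
  have hclosed : IsClosed (Set.range T) := T.isometry.isClosedEmbedding.isClosed_range
  have hET (m : ℕ) : E m ∈ Set.range T := by
    refine ⟨⟨⟨Pi.single m 1, continuous_of_discreteTopology⟩, ?_⟩, ?_⟩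
    · rw [cocompact_eq_atTop]
      refine tendsto_const_nhds.congr' ?_
      filter_upwards [eventually_gt_atTop m] with k hk
      exact (Pi.single_eq_of_ne (M := fun _ => K) hk.ne' 1).symm
    · change ∑' k, (Pi.single m 1 : ℕ → K) k • E k = E m
      rw [tsum_eq_single m fun k hk => by rw [Pi.single_eq_of_ne hk, zero_smul],
        Pi.single_eq_same, one_smul]
  have hsurj (x : C(IntegerRing K, K)) : ∃ c, T c = x := by
    have hx : x ∈ (Submodule.span K (Set.range E)).topologicalClosure :=
      topologicalClosure_span_eq_top hE hϖ hspan ▸ Submodule.mem_top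
    have hle : Submodule.span K (Set.range E) ≤ LinearMap.range T.toLinearMap :=
      Submodule.span_le.mpr fun _ ⟨m, hm⟩ => hm ▸ hET m
    exact Submodule.topologicalClosure_minimal _ hle hclosed hx
  intro x
  obtain ⟨c, rfl⟩ := hsurj x
  refine ⟨c, ⟨hlim c, (hsum c).hasSum⟩,
    isGreatest_norm_of_hasSum_smul hE hq hind (hlim c) (hsum c).hasSum, fun c' hc' hsum' => ?_⟩
  have h0 : HasSum (fun m => (c' m - c m) • E m) 0 := by
    have := hsum'.sub (hsum c).hasSum
    simp only [← sub_smul] at this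
    rwa [show ∑' m, c m • E m = T c from rfl, sub_self] at this
  have hlim0 : Tendsto (fun m => c' m - c m) atTop (𝓝 0) := by
    simpa using hc'.sub (hlim c)
  have hg := isGreatest_norm_of_hasSum_smul hE hq hind hlim0 h0
  funext m
  have := hg.2 ⟨m, rfl⟩
  rw [norm_zero, norm_le_zero_iff] at this
  exact sub_eq_zero.mp this

end Orthonormal

/-! ### Polynomiality of the coefficients, and the theorem. -/

namespace IsLubinTate

open PowerSeries

variable {K : Type*} [NontriviallyNormedField K] [IsUltrametricDist K] [LocallyCompactSpace K]
  {ϖ : IntegerRing K} {f : PowerSeries (IntegerRing K)} {F : FormalGroup (IntegerRing K)}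

/-- The coefficient functions are given by polynomials: they are the coefficients of the series
over `K[T]` with linear coefficient `T` that commutes with `f`. -/
theorem exists_polynomial (hF : IsLubinTate ϖ f F) :
    ∃ C : ℕ → Polynomial K, ∀ (n : ℕ) (a : IntegerRing K),
      (C n).eval (a : K) = ((coefficientFunction f F n a : IntegerRing K) : K) := by
  have f0 := hF.frobenius.constantCoeff_eq
  have sf : HasSubst f := HasSubst.of_constantCoeff_zero' f0
  have map0 {A B : Type _} [CommRing A] [CommRing B] (φ : A →+* B) {g : PowerSeries A}
      (hg : constantCoeff g = 0) : constantCoeff (g.map φ) = 0 := by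
    rw [← coeff_zero_eq_constantCoeff_apply, coeff_map, coeff_zero_eq_constantCoeff_apply, hg,
      map_zero]
  set ι : IntegerRing K →+* K := (IntegerRing K).subtype with hι
  have hιinj : Function.Injective ι := Subtype.val_injective
  have hne (n : ℕ) (hn : 2 ≤ n) :
      coeff 1 (f.map ι) - coeff 1 (f.map ι) ^ n ≠ 0 := by
    rw [coeff_map, ← map_pow, ← map_sub, Ne, map_eq_zero_iff ι hιinj]
    exact hF.coeff_one_sub_pow_ne_zero n hn
  -- Over `K[T]` the factor `ϖ - ϖ ^ n` is a nonzero constant, hence a unit, so no congruence is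
  -- needed.
  have hsolve (n : ℕ) (hn : 2 ≤ n) (y : Polynomial K) :
      ∃ x, (coeff 1 ((f.map ι).map Polynomial.C) - coeff 1 ((f.map ι).map Polynomial.C) ^ n) * x =
        y := by
    refine ⟨Polynomial.C (coeff 1 (f.map ι) - coeff 1 (f.map ι) ^ n)⁻¹ * y, ?_⟩
    rw [coeff_map Polynomial.C, ← map_pow, ← map_sub, ← mul_assoc, ← map_mul,
      mul_inv_cancel₀ (hne n hn), map_one, one_mul]
  obtain ⟨G, hG0, hG1, hGc⟩ := exists_commute (f := (f.map ι).map Polynomial.C)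
    (map0 _ (map0 _ f0)) (fun n hn g _ => hsolve n hn _) Polynomial.X
  refine ⟨fun n => coeff n G, fun n a => ?_⟩
  have hb := hF.isBracket_bracket (IntegerRing.residue_eq_zero_iff_dvd hF.irreducible) a
  have b0 := hb.isEndomorphism.constantCoeff_eq
  set ev : Polynomial K →+* K := Polynomial.evalRingHom (a : K) with hev
  have hfev : ((f.map ι).map Polynomial.C).map ev = f.map ι := by
    ext m
    simp [coeff_map, hev]
  -- Specialising `T` to `a` gives a series over `K` with linear coefficient `a` commuting with `f`,
  -- so uniqueness over `K` identifies it with `[a]`.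
  have key : G.map ev = (bracket f F a).map ι := by
    refine eq_of_commute (map0 ι f0) hne (map0 ev hG0) (map0 ι b0) ?_ ?_ ?_
    · rw [coeff_map, coeff_map, hG1, hb.coeff_one_eq, hev, Polynomial.coe_evalRingHom,
        Polynomial.eval_X]
      rfl
    · rw [← hfev, ← map_subst_powerSeries ev (HasSubst.of_constantCoeff_zero' hG0), hGc,
        map_subst_powerSeries ev (HasSubst.of_constantCoeff_zero' (map0 _ (map0 _ f0)))]
    · rw [← map_subst_powerSeries ι (HasSubst.of_constantCoeff_zero' b0), hb.commute,
        map_subst_powerSeries ι sf]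
  have := congrArg (coeff n) key
  rw [coeff_map, coeff_map] at this
  exact this

end IsLubinTate

theorem theorem5p13 (K : Type*) [NontriviallyNormedField K] [IsUltrametricDist K]
    [LocallyCompactSpace K] (ϖ : IntegerRing K) (f : PowerSeries (IntegerRing K))
    (F : FormalGroup (IntegerRing K)) (hF : IsLubinTate ϖ f F) :
    (∀ a : IntegerRing K, ∃! g : PowerSeries (IntegerRing K), IsBracket f F a g) ∧
    ∃ C : ℕ → Polynomial K,
      (∀ (n : ℕ) (a : IntegerRing K),
        (C n).eval (a : K) = ((coefficientFunction f F n a : IntegerRing K) : K)) ∧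
      IsOrthonormalBasis K fun m : ℕ =>
        polynomialFunction
          (digitExtension (Nat.card (IsLocalRing.ResidueField (IntegerRing K)))
            (fun j => C (Nat.card (IsLocalRing.ResidueField (IntegerRing K)) ^ j)) m) := by
  have hϖ := IntegerRing.residue_eq_zero_iff_dvd hF.irreducible
  refine ⟨hF.existsUnique_isBracket hϖ, ?_⟩
  obtain ⟨C, hC⟩ := hF.exists_polynomial
  refine ⟨C, hC, ?_⟩
  set q := Nat.card (IsLocalRing.ResidueField (IntegerRing K)) with hq
  have he (n : ℕ) (a b : IntegerRing K) :
      IsLocalRing.residue _ (coefficientFunction f F (q ^ n) (a + ϖ ^ n * b)) =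
        IsLocalRing.residue _ (coefficientFunction f F (q ^ n) a) + IsLocalRing.residue _ b :=
    hF.residue_coefficientFunction_add hϖ a b n
  refine isOrthonormalBasis_of_residue (q := q)
    (ε := fun m a => digitExtension q (fun j => coefficientFunction f F (q ^ j) a) m)
    (fun m a => ?_) Finite.one_lt_card hF.irreducible (fun n c h => ?_) fun n g hg => ?_
  · change Polynomial.evalRingHom (a : K) (digitExtension q (fun j => C (q ^ j)) m) =
      (IntegerRing K).subtype (digitExtension q (fun j => coefficientFunction f F (q ^ j) a) m)
    rw [map_digitExtension, map_digitExtension]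
    simp only [Polynomial.coe_evalRingHom, hC]
    rfl
  · simp only [map_digitExtension] at h
    exact DigitPrinciple.eq_zero_of_sum_eq_zero IsLocalRing.residue_surjective
      ((hϖ ϖ).mpr dvd_rfl)
      (e := fun n a => IsLocalRing.residue _ (coefficientFunction f F (q ^ n) a)) he n c h
  · simp only [map_digitExtension]
    exact DigitPrinciple.exists_eq_sum IsLocalRing.residue_surjective hϖ
      (e := fun n a => IsLocalRing.residue _ (coefficientFunction f F (q ^ n) a)) he n g hg
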